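/- Let $K$ be a perfect field in which $-1$ is not a square. Suppose that the absolute Galois group $\mathrm{Gal}(\overline{K}/K)$, with its Krull topology, is a pro-$2$ group (a profinite group in which every open normal subgroup has index a power of $2$), and that the Brauer group $\mathrm{Br}(K)$ is non-zero. Then either $K$ is real closed, or there is a quadratic extension $M/K$ (a field extension with $[M:K]=2$) such that $\mathrm{Br}(M)\neq 0$. Here, for a field $F$, $\mathrm{Br}(F)$ denotes the group of Brauer equivalence classes of finite-dimensional central simple $F$-algebras, where $A$ and $B$ are Brauer equivalent if the matrix algebras $M_n(A)$ and $M_m(B)$ are isomorphic as $F$-algebras for some $n,m\ge 1$. The class of $F$ is the zero element. -/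

import Mathlib

universe u

/-- A topological group `G` is a pro-`p` group (`p` a prime number) if it is a profinite group, i.e.
a compact, Hausdorff, totally disconnected topological group, and the index of every open normal
subgroup is a power of `p`; equivalently, `G` is an inverse limit of finite `p`-groups. -/
structure IsProPGroup (p : ℕ) [Fact p.Prime] (G : Type u) [Group G] [TopologicalSpace G] :
    Prop where
  isTopologicalGroup : IsTopologicalGroup G
  compactSpace : CompactSpace G
  t2Space : T2Space G
  totallyDisconnectedSpace : TotallyDisconnectedSpace G
  index_eq : ∀ N : Subgroup G, N.Normal → IsOpen (N : Set G) → ∃ k : ℕ, N.index = p ^ k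

/-- `Br(K) ≠ 0`: there is more than one Brauer equivalence class of finite-dimensional central
simple algebras over `K`. Every finite-dimensional `K`-algebra is isomorphic to one
whose underlying type lives in the universe of `K`, so that universe suffices. -/
def BrauerGroupNeZero (K : Type u) [Field K] : Prop :=
  Nontrivial (BrauerGroup.{u, u} K)

/-!
The proof assumes `Br(M) = 0` for every quadratic extension `M` of `K` and shows that `K` is real
closed, by elementary arithmetic of quaternion algebras instead of Galois cohomology.

If `Br(F) = 0`, then `F` is the only finite-dimensional central division algebra over `F`
(`finrank_eq_one_of_subsingleton_brauerGroup`); applied to quaternion algebras, this makes every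
conic `a x² + b y² = z²` over `F` isotropic (`exists_isotropic_of_subsingleton_brauerGroup`).

Put `M = K(i)` with `i² = -1`, and let `D ≠ K` be a central division algebra over `K`. As
`Br(M) = 0`, the algebra `M ⊗ D` is not a division algebra, so `D` contains a square root `d` of
`-1`, and the centralizer of `d`, being central over `M`, is `M` itself. Hence `D` is a quaternion
algebra `(-1, b)`, and `b` is not a sum of two squares
(`exists_not_sum_two_squares_of_sq_eq_neg_one`).

The crucial step (`exists_eq_sq_sub_mul_sq_of_eq_sum_two_squares`) is a corestriction argument: if
`e = x² + y²` is the norm of `x + y i ∈ M`, then the quaternion algebra `(x + y i, f)` over `M`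
splits, and taking norms down to `K` shows that `e` is a norm from `K(√f)`. With `e = -1` and
`f = b` it follows that `-1` is not a sum of two squares. Thus `(-1, -1)` is a division algebra,
and its splitting over `K(√c)` says that `-c` is a sum of three squares for every nonsquare `c`
(`neg_eq_sum_three_squares_of_subsingleton_brauerGroup`). If some `e = 1 + p²` were not a square,
then `-e = v₁² + v₂² + v₃²`, and the norm argument with `f = -(v₁² + v₂²)` would make `-1` a sum of
two squares. So sums of squares are squares, and for each `c` one of `c`, `-c` is a square.

Finally, since the Galois group is pro-`2`, irreducible polynomials of odd degree are linear, so
every polynomial of odd degree has a root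
(`exists_isRoot_of_odd_natDegree_of_isProPGroup`).
-/

/-! ### Division algebras and the Brauer group -/

theorem surjective_algebraMap_of_finrank_eq_one {F E : Type*} [Field F] [Ring E] [Nontrivial E]
    [Algebra F E] (h : Module.finrank F E = 1) : Function.Surjective (algebraMap F E) := by
  intro x
  obtain ⟨c, hc⟩ := (finrank_eq_one_iff_of_nonzero' (1 : E) one_ne_zero).1 h x
  exact ⟨c, by rw [Algebra.algebraMap_eq_smul_one, hc]⟩

/-- A finite-dimensional domain with a matrix algebra isomorphic to one over the base field is the
base field. The corner `ε A ε` of `A = Mₙ(E) ≃ Mₘ(F)` at a matrix unit `ε` of `Mₘ(F)` is a line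
over `F`, and `E` embeds into it. -/
theorem finrank_eq_one_of_matrix_algEquiv {F E : Type*} [Field F] [Ring E] [IsDomain E]
    [Algebra F E] [FiniteDimensional F E] {n m : ℕ} (hm : m ≠ 0)
    (e : Matrix (Fin n) (Fin n) E ≃ₐ[F] Matrix (Fin m) (Fin m) F) :
    Module.finrank F E = 1 := by
  classical
  have := NeZero.mk hm
  let ε : Matrix (Fin n) (Fin n) E := e.symm (Matrix.single 0 0 1)
  have hε : ε ≠ 0 := by
    intro h
    have h1 : Matrix.single (0 : Fin m) (0 : Fin m) (1 : F) = 0 := by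
      simpa [ε] using h
    simpa using congrFun (congrFun h1 0) 0
  obtain ⟨p, q, hpq⟩ : ∃ p q, ε p q ≠ 0 := by
    by_contra! h
    exact hε (Matrix.ext h)
  -- The coefficient of `ε (single q p c) ε` with respect to `ε`.
  let f : E →ₗ[F] F :=
    { toFun := fun c => e (Matrix.single q p c) 0 0
      map_add' := fun a b => by simp [Matrix.single_add]
      map_smul' := fun a b => by simp [← Matrix.smul_single] }
  have hf : Function.Injective f := by
    rw [injective_iff_map_eq_zero]
    intro c hc
    have h1 : Matrix.single (0 : Fin m) (0 : Fin m) (1 : F) * e (Matrix.single q p c) *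
        Matrix.single (0 : Fin m) (0 : Fin m) (1 : F) = 0 := by
      rw [Matrix.single_mul_mul_single]
      have : e (Matrix.single q p c) 0 0 = 0 := hc
      simp [this]
    have h2 : ε * Matrix.single q p c * ε = 0 := by
      apply e.injective
      simpa [ε] using h1
    have h3 : ε p q * c * ε p q = 0 := by
      have := congrFun (congrFun h2 p) q
      rw [Matrix.mul_assoc, Matrix.mul_apply] at this
      rw [Finset.sum_eq_single q] at this
      · simpa [mul_assoc] using this
      · intro j _ hj
        rw [Matrix.single_mul_apply_of_ne _ _ _ _ _ hj, mul_zero]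
      · simp
    simpa [hpq] using h3
  have h1 : Module.finrank F E ≤ 1 := by
    simpa using LinearMap.finrank_le_finrank_of_injective hf
  have h2 : 0 < Module.finrank F E := Module.finrank_pos
  omega

/-- Over a field with trivial Brauer group, every finite-dimensional central division algebra is
trivial. -/
theorem finrank_eq_one_of_subsingleton_brauerGroup (F : Type u) [Field F]
    (hF : Subsingleton (BrauerGroup.{u, u} F)) (E : Type u) [Ring E] [IsDomain E] [Algebra F E]
    [FiniteDimensional F E] [Algebra.IsCentral F E] : Module.finrank F E = 1 := by
  let : DivisionRing E := divisionRingOfFiniteDimensional F E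
  have hs : IsSimpleRing E := inferInstance
  let A : CSA.{u, u} F := { carrier := E }
  let B : CSA.{u, u} F := { carrier := F }
  obtain ⟨n, m, hn, hm, ⟨e⟩⟩ : IsBrauerEquivalent A B :=
    Quotient.exact (s := Brauer.CSA_Setoid F) (hF.elim ⟦A⟧ ⟦B⟧)
  exact finrank_eq_one_of_matrix_algEquiv hm e

theorem exists_central_divisionRing_of_nontrivial_brauerGroup (K : Type u) [Field K]
    (hK : Nontrivial (BrauerGroup.{u, u} K)) :
    ∃ (D : Type u) (_ : DivisionRing D) (_ : Algebra K D), FiniteDimensional K D ∧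
      Algebra.IsCentral K D ∧ Module.finrank K D ≠ 1 := by
  by_contra! H
  have key : ∀ A : CSA.{u, u} K, IsBrauerEquivalent A { carrier := K } := by
    intro A
    have : IsArtinianRing A := IsArtinianRing.of_finite K A
    obtain ⟨n, hn, D, _, _, hfin, ⟨e⟩⟩ :=
      IsSimpleRing.exists_algEquiv_matrix_divisionRing_finite K A
    have hc : Algebra.IsCentral K D := by
      have : Algebra.IsCentral K (Matrix (Fin n) (Fin n) D) := Algebra.IsCentral.of_algEquiv K _ _ e
      refine ⟨fun d hd => ?_⟩
      have h1 : Matrix.scalar (Fin n) d ∈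
          Subalgebra.center K (Matrix (Fin n) (Fin n) D) := by
        rw [Matrix.subalgebraCenter_eq_scalarAlgHom_map]
        exact ⟨d, hd, rfl⟩
      obtain ⟨a, ha⟩ := Algebra.IsCentral.mem_center_iff K |>.1 h1
      refine Algebra.mem_bot.2 ⟨a, ?_⟩
      have := congrFun (congrFun ha 0) 0
      simpa [Matrix.algebraMap_matrix_apply] using this.symm
    have h1 := H D _ _ hfin hc
    have hb : Function.Bijective (algebraMap K D) :=
      ⟨FaithfulSMul.algebraMap_injective K D, surjective_algebraMap_of_finrank_eq_one h1⟩
    let g : K ≃ₐ[K] D := AlgEquiv.ofBijective (Algebra.ofId K D) hb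
    exact ⟨1, 1 * n, one_ne_zero, by simpa using hn.out,
      ⟨(e.trans g.symm.mapMatrix).mapMatrix.trans ((Matrix.compAlgEquiv _ _ _ _).trans
        (Matrix.reindexAlgEquiv K K finProdFinEquiv))⟩⟩
  obtain ⟨x, y, hxy⟩ := hK
  induction x using Quotient.inductionOn
  induction y using Quotient.inductionOn
  exact hxy (Quotient.sound ((key _).trans (key _).symm))
open Quaternion in
/-- If `Br(F) = 0`, then the conic `a x² + b y² = z²` has a point over `F`, as otherwise the
quaternion algebra `(a, b)` would be a central division algebra of dimension four. -/
theorem exists_isotropic_of_subsingleton_brauerGroup (F : Type u) [Field F]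
    (h2 : (2 : F) ≠ 0)
    (hF : Subsingleton (BrauerGroup.{u, u} F)) (a b : F) :
    ∃ x y z : F, (x ≠ 0 ∨ y ≠ 0 ∨ z ≠ 0) ∧ a * x ^ 2 + b * y ^ 2 = z ^ 2 := by
  by_contra! H
  have ha : a ≠ 0 := fun h => H 1 0 0 (by simp) (by simp [h])
  have hb : b ≠ 0 := fun h => H 0 1 0 (by simp) (by simp [h])
  have hz : ∀ x y z : F, a * x ^ 2 + b * y ^ 2 = z ^ 2 → x = 0 ∧ y = 0 ∧ z = 0 := by
    intro x y z h
    by_contra hne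
    refine H x y z ?_ h
    tauto
  -- The norm form of the quaternion algebra is anisotropic: if it vanishes, then `b` is a quotient
  -- of two values of `x² - a y²`, hence (clearing denominators) the conic has a point.
  have hN : ∀ r p q s : F, r ^ 2 - a * p ^ 2 - b * q ^ 2 + a * b * s ^ 2 = 0 →
      r = 0 ∧ p = 0 ∧ q = 0 ∧ s = 0 := by
    intro r p q s h
    have h4 : a * s ^ 2 + b * 0 ^ 2 = q ^ 2 := by
      have := (hz _ _ _ (by
        linear_combination (-(q ^ 2 - a * s ^ 2)) * h :
        a * (r * s + p * q) ^ 2 + b * (q ^ 2 - a * s ^ 2) ^ 2 = (r * q + a * p * s) ^ 2)).2.1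
      linear_combination -this
    obtain ⟨rfl, -, rfl⟩ := hz _ _ _ h4
    obtain ⟨rfl, -, rfl⟩ := hz p 0 r (by linear_combination -h)
    simp
  have hstar : ∀ (x : ℍ[F, a, 0, b]) (c : F),
      x.re ^ 2 - a * x.imI ^ 2 - b * x.imJ ^ 2 + a * b * x.imK ^ 2 = c →
      star x * x = algebraMap F _ c := by
    intro x c hc
    ext <;> simp <;> first | linear_combination hc | ring
  have : NoZeroDivisors ℍ[F, a, 0, b] := by
    refine ⟨fun {x y} hxy => ?_⟩
    by_cases hx : x.re ^ 2 - a * x.imI ^ 2 - b * x.imJ ^ 2 + a * b * x.imK ^ 2 = 0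
    · left
      obtain ⟨h1, h2, h3, h4⟩ := hN _ _ _ _ hx
      ext <;> assumption
    · right
      have h1 : star x * x * y = 0 := by rw [mul_assoc, hxy, mul_zero]
      rw [hstar x _ rfl, ← Algebra.smul_def] at h1
      exact (smul_eq_zero.1 h1).resolve_left hx
  have : IsDomain ℍ[F, a, 0, b] := NoZeroDivisors.to_isDomain _
  have : Algebra.IsCentral F ℍ[F, a, 0, b] := by
    refine ⟨fun x hx => ?_⟩
    rw [Subalgebra.mem_center_iff] at hx
    have hi := hx ⟨0, 1, 0, 0⟩
    have hj := hx ⟨0, 0, 1, 0⟩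
    have e1 := congrArg QuaternionAlgebra.imK hi
    have e2 := congrArg QuaternionAlgebra.imJ hi
    have e3 := congrArg QuaternionAlgebra.imK hj
    simp at e1 e2 e3
    have q0 : x.imJ = 0 := by
      have : 2 * x.imJ = 0 := by linear_combination e1
      simpa [h2] using this
    have s0 : x.imK = 0 := by
      have : 2 * a * x.imK = 0 := by linear_combination e2
      simpa [h2, ha] using this
    have p0 : x.imI = 0 := by
      have : 2 * x.imI = 0 := by linear_combination -e3
      simpa [h2] using this
    refine Algebra.mem_bot.2 ⟨x.re, ?_⟩
    ext <;> simp [q0, s0, p0]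
  have h1 := finrank_eq_one_of_subsingleton_brauerGroup F hF ℍ[F, a, 0, b]
  rw [QuaternionAlgebra.finrank_eq_four] at h1
  omega

/-! ### Division algebras split by adjoining a square root of `-1` -/
open scoped TensorProduct in
/-- A nontrivial central division algebra `D` over `K` contains a square root of `-1` if
`Br(K(i)) = 0`: otherwise `K(i) ⊗ D` would again be a central division algebra. -/
theorem exists_sq_eq_neg_one_of_subsingleton_brauerGroup {K : Type u} [Field K]
    {M : Type u} [Field M] [Algebra K M] (hM : Module.finrank K M = 2)
    (hBr : Subsingleton (BrauerGroup.{u, u} M)) {i : M} (hi : i ^ 2 = -1)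
    (hspan : ∀ z : M, ∃ a b : K, z = algebraMap K M a + algebraMap K M b * i)
    {D : Type u} [DivisionRing D] [Algebra K D] [FiniteDimensional K D] [Algebra.IsCentral K D]
    (hD : Module.finrank K D ≠ 1) : ∃ d : D, d ^ 2 = -1 := by
  by_contra! H
  have : FiniteDimensional K M := Module.finite_of_finrank_pos (by omega)
  -- Coordinates with respect to the `D`-basis `1, i` of `M ⊗ D`.
  let f : D × D →ₗ[K] M ⊗[K] D :=
    (TensorProduct.mk K M D 1).coprod (TensorProduct.mk K M D i)
  have hf : ∀ a b, f (a, b) = 1 ⊗ₜ a + i ⊗ₜ b := fun a b => rfl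
  have hsurj : Function.Surjective f := by
    intro x
    induction x using TensorProduct.induction_on with
    | zero => exact ⟨0, map_zero f⟩
    | tmul z d =>
      obtain ⟨a, b, rfl⟩ := hspan z
      refine ⟨(a • d, b • d), ?_⟩
      rw [hf, TensorProduct.add_tmul, ← Algebra.smul_def, Algebra.algebraMap_eq_smul_one,
        TensorProduct.smul_tmul, TensorProduct.smul_tmul]
    | add x y hx hy =>
      obtain ⟨x, rfl⟩ := hx
      obtain ⟨y, rfl⟩ := hy
      exact ⟨x + y, map_add f x y⟩
  have hinj : Function.Injective f := by
    refine (LinearMap.injective_iff_surjective_of_finrank_eq_finrank ?_).2 hsurj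
    rw [Module.finrank_prod, Module.finrank_tensorProduct, hM, two_mul]
  have hmul : ∀ a b c d, f (a, b) * f (c, d) = f (a * c - b * d, a * d + b * c) := by
    intro a b c d
    have hii : i * i = -1 := by rw [← sq, hi]
    simp only [hf, add_mul, mul_add, Algebra.TensorProduct.tmul_mul_tmul, one_mul, mul_one, hii,
      TensorProduct.tmul_add, TensorProduct.tmul_sub, TensorProduct.neg_tmul]
    abel
  have : NoZeroDivisors (M ⊗[K] D) := by
    refine ⟨fun {x y} hxy => ?_⟩
    obtain ⟨⟨a, b⟩, rfl⟩ := hsurj x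
    obtain ⟨⟨c, d⟩, rfl⟩ := hsurj y
    rw [hmul, ← map_zero f] at hxy
    obtain ⟨h1, h2⟩ := Prod.ext_iff.1 (hinj hxy)
    simp only [Prod.fst_zero, Prod.snd_zero] at h1 h2
    suffices h : (a, b) = 0 ∨ (c, d) = 0 by
      rcases h with h | h <;> simp [h]
    by_cases hb : b = 0
    · subst hb
      by_cases ha : a = 0
      · simp [ha]
      · right
        simpa [ha] using And.intro h1 h2
    · right
      have hd : d = b⁻¹ * a * c := by
        rw [mul_assoc, sub_eq_zero.1 h1, inv_mul_cancel_left₀ hb]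
      have hc : c = -(b⁻¹ * a * d) := by
        rw [mul_assoc, eq_neg_of_add_eq_zero_left h2, mul_neg, neg_neg,
          inv_mul_cancel_left₀ hb]
      have h3 : ((b⁻¹ * a) ^ 2 + 1) * c = 0 := by
        rw [add_mul, sq, mul_assoc, ← hd, one_mul, add_comm]
        exact eq_neg_iff_add_eq_zero.1 hc
      have hc0 : c = 0 := by
        refine (mul_eq_zero.1 h3).resolve_left fun h => H _ (eq_neg_of_add_eq_zero_left h)
      rw [hc0, mul_zero] at hd
      simp [hc0, hd]
  have : IsDomain (M ⊗[K] D) := NoZeroDivisors.to_isDomain _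
  have : Algebra.IsCentral M (M ⊗[K] D) := by
    refine ⟨fun x hx => ?_⟩
    rw [Subalgebra.mem_center_iff] at hx
    obtain ⟨⟨a, b⟩, rfl⟩ := hsurj x
    have h : ∀ d, d * a = a * d ∧ d * b = b * d := by
      intro d
      have := hx (f (d, 0))
      rw [hmul, hmul] at this
      have := Prod.ext_iff.1 (hinj this)
      simpa using this
    obtain ⟨a', rfl⟩ := (Algebra.IsCentral.mem_center_iff K).1
      (Subalgebra.mem_center_iff.2 fun d => (h d).1)
    obtain ⟨b', rfl⟩ := (Algebra.IsCentral.mem_center_iff K).1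
      (Subalgebra.mem_center_iff.2 fun d => (h d).2)
    refine Algebra.mem_bot.2 ⟨algebraMap K M a' + algebraMap K M b' * i, ?_⟩
    rw [hf, Algebra.TensorProduct.algebraMap_apply, Algebra.algebraMap_self, RingHom.id_apply,
      TensorProduct.add_tmul, ← Algebra.smul_def,
      Algebra.algebraMap_eq_smul_one, Algebra.algebraMap_eq_smul_one,
      Algebra.algebraMap_eq_smul_one, TensorProduct.smul_tmul, TensorProduct.smul_tmul]
  have h1 := finrank_eq_one_of_subsingleton_brauerGroup M hBr (M ⊗[K] D)
  rw [Module.finrank_baseChange] at h1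
  exact hD h1

/-- Suppose that `Br(K(i)) = 0` and that the central division algebra `D` contains `d = g i` with
`d² = -1`. Then the centralizer of `d` is `K(i)`, so an element `j` anticommuting with `d` has
`j² = b ∈ K`, and `b` is not a norm `x² + y²` from `K(i)`, as `D` has no zero divisors. -/
theorem exists_not_sum_two_squares_of_sq_eq_neg_one {K : Type u} [Field K]
    (h2 : (2 : K) ≠ 0) (hsq : ¬ IsSquare (-1 : K)) {M : Type u} [Field M] [Algebra K M]
    (hBr : Subsingleton (BrauerGroup.{u, u} M)) {i : M}
    (hspan : ∀ z : M, ∃ a b : K, z = algebraMap K M a + algebraMap K M b * i)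
    {D : Type u} [DivisionRing D] [Algebra K D] [FiniteDimensional K D] [Algebra.IsCentral K D]
    (g : M →ₐ[K] D) {d : D} (hd : d ^ 2 = -1) (hg : g i = d) :
    ∃ b : K, ∀ x y : K, b ≠ x ^ 2 + y ^ 2 := by
  have hdd : d * d = -1 := by rw [← sq, hd]
  have h2D : (2 : D) ≠ 0 := by
    intro h
    apply h2
    apply FaithfulSMul.algebraMap_injective K D
    rw [map_ofNat, h, map_zero]
  have hd0 : d ≠ 0 := by
    rintro rfl
    simp at hd
  have hgc : ∀ z : M, ∃ a b : K, g z = algebraMap K D a + algebraMap K D b * d := by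
    intro z
    obtain ⟨a, b, rfl⟩ := hspan z
    exact ⟨a, b, by simp [hg]⟩
  -- An element anticommuting with `d`.
  obtain ⟨j, hj0, hdj⟩ : ∃ j : D, j ≠ 0 ∧ d * j = -(j * d) := by
    by_contra! H
    have hcen : d ∈ Subalgebra.center K D := by
      rw [Subalgebra.mem_center_iff]
      intro x
      by_contra hne
      refine H (x * d - d * x) (sub_ne_zero.2 hne) ?_
      rw [mul_sub, sub_mul, ← mul_assoc d d x, hdd, mul_assoc x d d, hdd]
      simp [mul_assoc]
    obtain ⟨a, rfl⟩ := (Algebra.IsCentral.mem_center_iff K).1 hcen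
    refine hsq ⟨a, ?_⟩
    apply FaithfulSMul.algebraMap_injective K D
    rw [map_mul, ← sq, hd, map_neg, map_one]
  -- The centralizer of `d`, an algebra over `M` through `g`.
  let C : Subalgebra K D := Subalgebra.centralizer K {d}
  have memC : ∀ x : D, x ∈ C ↔ d * x = x * d := by
    intro x
    simp [C, Subalgebra.mem_centralizer_iff]
  have hgC : ∀ z : M, ∀ x : D, x ∈ C → g z * x = x * g z := by
    intro z x hx
    obtain ⟨a, b, h⟩ := hgc z
    rw [h, add_mul, mul_add, mul_assoc, (memC x).1 hx, Algebra.commutes, ← mul_assoc,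
      Algebra.commutes b, mul_assoc]
  let gC : M →ₐ[K] C := g.codRestrict C fun z => by
    rw [memC, ← hg, ← map_mul, ← map_mul, mul_comm]
  let : Algebra M C := gC.toRingHom.toAlgebra' fun z x => Subtype.ext (hgC z x x.2)
  have hmap : ∀ z : M, ((algebraMap M C z : C) : D) = g z := fun z => rfl
  have : IsScalarTower K M C := IsScalarTower.of_algebraMap_eq fun a => by
    apply Subtype.ext
    rw [hmap, AlgHom.commutes]
    rfl
  have : FiniteDimensional M C := Module.Finite.of_restrictScalars_finite K M C
  have : Algebra.IsCentral M C := by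
    refine ⟨fun z hz => ?_⟩
    rw [Subalgebra.mem_center_iff] at hz
    obtain ⟨z, hzC⟩ := z
    have hz' : ∀ x ∈ C, x * z = z * x := fun x hx => congrArg Subtype.val (hz ⟨x, hx⟩)
    have hdz := (memC z).1 hzC
    have hji : d * j⁻¹ = -(j⁻¹ * d) := by
      have h1 : j⁻¹ * (d * j) * j⁻¹ = j⁻¹ * (-(j * d)) * j⁻¹ := by rw [hdj]
      have h2 : j⁻¹ * d = -(d * j⁻¹) := by simpa [mul_assoc, hj0] using h1
      rw [h2, neg_neg]
    have hjC : j * j ∈ C := by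
      rw [memC, ← mul_assoc, hdj, neg_mul, mul_assoc, hdj, mul_neg, neg_neg, mul_assoc]
    have hconj : ∀ x ∈ C, j⁻¹ * x * j ∈ C := by
      intro x hx
      rw [memC, ← mul_assoc, ← mul_assoc, hji, mul_assoc _ j d, ← neg_eq_iff_eq_neg.2 hdj, mul_neg,
        neg_mul, neg_mul, mul_assoc j⁻¹ d x, (memC x).1 hx]
      simp only [mul_assoc]
    -- `D = C + C j`, so commuting with `C` and `j` suffices for centrality.
    have hcen : ∀ w : D, (∀ x ∈ C, x * w = w * x) → j * w = w * j →
        ∃ a : K, w = algebraMap K D a := by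
      intro w hwC hwj
      refine (Algebra.IsCentral.mem_center_iff K).1 (Subalgebra.mem_center_iff.2 fun x => ?_)
      have h1 : (x - d * x * d) * w = w * (x - d * x * d) := by
        refine hwC _ ?_
        rw [memC, mul_sub, sub_mul, ← mul_assoc, ← mul_assoc, hdd, mul_assoc _ d d, hdd]
        simp [sub_eq_add_neg, add_comm]
      have hy : d * (x + d * x * d) = -((x + d * x * d) * d) := by
        rw [mul_add, add_mul, ← mul_assoc, ← mul_assoc, hdd, mul_assoc _ d d, hdd]
        simp
      have h2 : (x + d * x * d) * j⁻¹ * w = w * ((x + d * x * d) * j⁻¹) := by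
        refine hwC _ ?_
        rw [memC, ← mul_assoc, hy, neg_mul, mul_assoc, hji, mul_neg, neg_neg, mul_assoc _ j⁻¹ d]
      have h3 : (x + d * x * d) * w = w * (x + d * x * d) := by
        have h4 : (x + d * x * d) * j⁻¹ * w * j = w * ((x + d * x * d) * j⁻¹) * j := by rw [h2]
        rw [mul_assoc _ w j, ← hwj] at h4
        simpa [mul_assoc, hj0] using h4
      have h5 : 2 * (x * w) = 2 * (w * x) := by
        have h6 := congrArg₂ (· + ·) h1 h3
        simp only [← add_mul, ← mul_add, sub_add_add_cancel] at h6
        rw [two_mul, two_mul, ← add_mul, ← mul_add, h6]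
      exact mul_left_cancel₀ h2D h5
    -- The conjugate of `z` by `j`.
    obtain ⟨z', hz'j⟩ : ∃ z' : D, z' * j = j * z := ⟨j * z * j⁻¹, by simp [mul_assoc, hj0]⟩
    have hjz' : j * z' = z * j := by
      have h1 : j * z' * j = z * j * j := by
        rw [mul_assoc, hz'j, ← mul_assoc, hz' _ hjC, mul_assoc]
      exact mul_right_cancel₀ hj0 h1
    have hz'C : ∀ x ∈ C, x * z' = z' * x := by
      intro x hx
      have h1 : x * z' * j = z' * x * j := by
        have h2 : x * j = j * (j⁻¹ * x * j) := by simp [mul_assoc, hj0]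
        rw [mul_assoc, hz'j, ← mul_assoc, h2, mul_assoc, hz' _ (hconj x hx), ← mul_assoc,
          ← hz'j, mul_assoc, ← h2, mul_assoc]
      exact mul_right_cancel₀ hj0 h1
    have hdz' : d * z' = z' * d := hz'C d ((memC d).2 rfl)
    -- Both `z + z'` and `(z - z') d` are central in `D`, hence scalars, which determines `z`.
    obtain ⟨a, ha⟩ := hcen (z + z')
      (fun x hx => by rw [mul_add, add_mul, hz' x hx, hz'C x hx])
      (by rw [mul_add, add_mul, hjz', hz'j, add_comm])
    obtain ⟨b, hb⟩ := hcen ((z - z') * d)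
      (fun x hx => by
        rw [← mul_assoc, mul_sub, hz' x hx, hz'C x hx, ← sub_mul, mul_assoc, mul_assoc,
          (memC x).1 hx])
      (by
        rw [← mul_assoc, mul_sub, hjz', mul_assoc, hdj, mul_neg, ← mul_assoc, sub_mul z z' j,
          hz'j, ← neg_mul, neg_sub])
    refine Algebra.mem_bot.2 ⟨algebraMap K M (a / 2) + algebraMap K M (-b / 2) * i, ?_⟩
    apply Subtype.ext
    rw [hmap]
    apply mul_left_cancel₀ h2D
    have e1 : (2 : D) = algebraMap K D 2 := (map_ofNat _ 2).symm
    have e2 : z - z' = algebraMap K D (-b) * d := by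
      rw [map_neg, ← hb, neg_mul, mul_assoc, hdd, mul_neg, mul_one, neg_neg]
    calc 2 * g (algebraMap K M (a / 2) + algebraMap K M (-b / 2) * i)
        = algebraMap K D a + algebraMap K D (-b) * d := by
          rw [map_add, map_mul, AlgHom.commutes, AlgHom.commutes, hg, mul_add, e1, ← mul_assoc,
            ← map_mul, ← map_mul, mul_div_cancel₀ _ h2, mul_div_cancel₀ _ h2]
      _ = 2 * z := by rw [← ha, ← e2, two_mul]; abel
  have hC : ∀ x ∈ C, ∃ a b : K, x = algebraMap K D a + algebraMap K D b * d := by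
    intro x hx
    obtain ⟨z, hz⟩ := surjective_algebraMap_of_finrank_eq_one
      (finrank_eq_one_of_subsingleton_brauerGroup M hBr C) ⟨x, hx⟩
    obtain ⟨a, b, h⟩ := hgc z
    exact ⟨a, b, by rw [← h, ← hmap, hz]⟩
  have hjd : j * d = -(d * j) := by rw [hdj, neg_neg]
  obtain ⟨a, b, hab⟩ := hC (j * j) (by
    rw [memC, ← mul_assoc, hdj, neg_mul, mul_assoc, hdj, mul_neg, neg_neg, mul_assoc])
  have hb : algebraMap K D b = 0 := by
    have h1 : j * (j * j) = j * j * j := (mul_assoc _ _ _).symm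
    rw [hab, mul_add, add_mul, Algebra.commutes a, add_right_inj, ← mul_assoc,
      ← Algebra.commutes b, mul_assoc, mul_assoc, hdj, mul_neg, ← sub_eq_zero,
      sub_neg_eq_add, ← two_mul] at h1
    simpa [h2D, hj0, hd0] using h1
  rw [hb, zero_mul, add_zero] at hab
  refine ⟨a, fun x y h => ?_⟩
  -- If `j² = x² + y²`, then `j` would lie in the centralizer of `d`.
  have h3 : (j - (algebraMap K D x - algebraMap K D y * d)) *
      (j + (algebraMap K D x + algebraMap K D y * d)) = 0 := by
    have e1 : j * algebraMap K D x = algebraMap K D x * j := (Algebra.commutes _ _).symm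
    have e2 : j * (algebraMap K D y * d) = -(algebraMap K D y * d * j) := by
      rw [← mul_assoc, ← Algebra.commutes y, mul_assoc, hjd, mul_neg, mul_assoc]
    have e3 : (algebraMap K D x - algebraMap K D y * d) *
        (algebraMap K D x + algebraMap K D y * d) = algebraMap K D a := by
      have e4 : algebraMap K D y * d * (algebraMap K D y * d) = - algebraMap K D (y ^ 2) := by
        rw [mul_assoc, ← mul_assoc d, ← Algebra.commutes y d, mul_assoc _ d d, hdd]
        simp [sq]
      have e5 : algebraMap K D y * d * algebraMap K D x =
          algebraMap K D x * (algebraMap K D y * d) := (Algebra.commutes _ _).symm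
      rw [sub_mul, mul_add, mul_add, e4, e5, h]
      simp only [sq, map_add, map_mul]
      abel
    rw [sub_mul, mul_add, mul_add j, mul_add (_ - _), e3, hab, e1, e2, sub_mul]
    abel
  have h4 : d * j = j * d := by
    rcases mul_eq_zero.1 h3 with h | h
    · rw [sub_eq_zero.1 h, mul_sub, sub_mul, Algebra.commutes x, ← mul_assoc,
        ← Algebra.commutes y d]
    · rw [eq_neg_of_add_eq_zero_left h, mul_neg, neg_mul, mul_add, add_mul, Algebra.commutes x,
        ← mul_assoc, ← Algebra.commutes y d]
  rw [h4, ← sub_eq_zero, sub_neg_eq_add, ← two_mul] at hdj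
  simp [h2D, hj0, hd0] at hdj

/-! ### Quadratic extensions and roots of odd degree polynomials -/

open Polynomial IntermediateField in
/-- Adjunction of a square root `s` of a nonsquare `c`, with the universal property stated for
noncommutative target algebras as well. -/
theorem exists_quadratic_extension {K : Type u} [Field K] {c : K} (hc : ¬ IsSquare c) :
    ∃ (M : IntermediateField K (AlgebraicClosure K)) (s : M), Module.finrank K M = 2 ∧
      s ^ 2 = algebraMap K M c ∧
      (∀ z : M, ∃ a b : K, z = algebraMap K M a + algebraMap K M b * s) ∧
      ∀ (D : Type u) [Ring D] [Algebra K D] (d : D), d ^ 2 = algebraMap K D c →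
        ∃ g : M →ₐ[K] D, g s = d := by
  obtain ⟨t, ht⟩ := IsAlgClosed.exists_pow_nat_eq (algebraMap K (AlgebraicClosure K) c)
    (n := 2) two_pos
  have hint : IsIntegral K t := Algebra.IsIntegral.isIntegral t
  have hdeg : (X ^ 2 - C c : K[X]).natDegree = 2 := natDegree_X_pow_sub_C
  have hmin : minpoly K t = X ^ 2 - C c := by
    refine (minpoly.eq_of_irreducible_of_monic ?_ (by simp [ht])
      (monic_X_pow_sub_C c two_ne_zero)).symm
    rw [irreducible_iff_roots_eq_zero_of_degree_le_three (by rw [hdeg]) (by rw [hdeg]; norm_num)]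
    refine Multiset.eq_zero_of_forall_notMem fun x hx => hc ⟨x, ?_⟩
    have := (mem_roots'.1 hx).2
    simp only [IsRoot.def, eval_sub, eval_pow, eval_X, eval_C] at this
    rw [← sq]
    exact (sub_eq_zero.1 this).symm
  let pb := adjoin.powerBasis hint
  have hpb : pb.dim = 2 := by rw [adjoin.powerBasis_dim, hmin, hdeg]
  have hgen : pb.gen = AdjoinSimple.gen K t := adjoin.powerBasis_gen hint
  refine ⟨K⟮t⟯, AdjoinSimple.gen K t, ?_, ?_, fun z => ?_, fun D _ _ d hd => ?_⟩
  · rw [pb.finrank, hpb]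
  · apply Subtype.ext
    simpa using ht
  · obtain ⟨f, hf, hz⟩ := pb.exists_eq_aeval z
    rw [hgen] at hz
    rw [hpb] at hf
    refine ⟨f.coeff 0, f.coeff 1, ?_⟩
    rw [hz]
    conv_lhs => rw [eq_X_add_C_of_natDegree_le_one (show f.natDegree ≤ 1 by omega)]
    simp [add_comm]
  · have h : aeval d (minpoly K pb.gen) = 0 := by
      rw [hgen, minpoly_gen, hmin]
      simp [hd]
    refine ⟨pb.lift d h, ?_⟩
    rw [← hgen]
    exact pb.lift_gen d h

open Polynomial IntermediateField in
/-- If the absolute Galois group of a perfect field is pro-`2`, then polynomials of odd degree have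
roots. An irreducible factor of odd degree `n` defines an extension whose normal closure has degree
a power of `2`, so that `n` divides this power and `n = 1`. -/
theorem exists_isRoot_of_odd_natDegree_of_isProPGroup {K : Type u} [Field K] [PerfectField K]
    (hG : IsProPGroup 2 (Field.absoluteGaloisGroup K)) {f : K[X]} (hf : Odd f.natDegree) :
    ∃ x, f.IsRoot x := by
  induction hn : f.natDegree using Nat.strong_induction_on generalizing f with
  | _ n ih =>
  obtain ⟨g, hg, h, rfl⟩ := exists_irreducible_of_natDegree_ne_zero hf.pos.ne'
  have hgh0 : g * h ≠ 0 := by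
    intro h0
    simp [h0] at hf
  have hadd : (g * h).natDegree = g.natDegree + h.natDegree :=
    natDegree_mul (left_ne_zero_of_mul hgh0) (right_ne_zero_of_mul hgh0)
  rcases Nat.even_or_odd g.natDegree with hge | hgo
  · have hho : Odd h.natDegree := by
      rw [hadd] at hf
      exact (Nat.odd_add'.1 hf).2 hge
    obtain ⟨x, hx⟩ := ih _ (by have := hg.natDegree_pos; omega) hho rfl
    exact ⟨x, hx.dvd (dvd_mul_left _ _)⟩
  · obtain ⟨α, hα⟩ := IsAlgClosed.exists_aeval_eq_zero (AlgebraicClosure K) g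
      (degree_pos_of_irreducible hg).ne'
    let L : IntermediateField K (AlgebraicClosure K) :=
      normalClosure K K⟮α⟯ (AlgebraicClosure K)
    have hint : IsIntegral K α := Algebra.IsIntegral.isIntegral α
    have : FiniteDimensional K K⟮α⟯ := adjoin.finiteDimensional hint
    have : FiniteDimensional K L := normalClosure.is_finiteDimensional K K⟮α⟯ _
    have : Normal K L := normalClosure.normal K K⟮α⟯ _
    have hidx : ∀ N : Subgroup Gal(AlgebraicClosure K/K), N.Normal →
        IsOpen (N : Set Gal(AlgebraicClosure K/K)) → ∃ k : ℕ, N.index = 2 ^ k := hG.index_eq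
    obtain ⟨k, hk⟩ := hidx L.fixingSubgroup inferInstance L.fixingSubgroup_isOpen
    rw [← finrank_eq_fixingSubgroup_index] at hk
    have hle : K⟮α⟯ ≤ L := K⟮α⟯.le_normalClosure
    have hdvd : Module.finrank K K⟮α⟯ ∣ 2 ^ k := by
      rw [← hk]
      exact finrank_dvd_of_le_right hle
    have hdeg : Module.finrank K K⟮α⟯ = g.natDegree := by
      rw [adjoin.finrank hint, ← minpoly.eq_of_irreducible hg hα,
        natDegree_mul_C (inv_ne_zero (leadingCoeff_ne_zero.2 hg.ne_zero))]
    rw [hdeg] at hdvd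
    have hone : g.natDegree = 1 :=
      Nat.Coprime.eq_one_of_dvd (Nat.Coprime.pow_right k hgo.coprime_two_right) hdvd
    obtain ⟨x, hx⟩ := exists_root_of_degree_eq_one
      ((degree_eq_iff_natDegree_eq_of_pos one_pos).2 hone)
    exact ⟨x, hx.dvd (dvd_mul_right _ _)⟩

/-! ### Sums of squares -/

/-- The elements `1` and `√c` are linearly independent over `K` if `c` is not a square. -/
theorem eq_zero_of_algebraMap_add_mul_eq_zero {K M : Type*} [Field K] [Field M] [Algebra K M]
    {c : K} (hc : ¬ IsSquare c) {s : M} (hs : s ^ 2 = algebraMap K M c) {a b : K}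
    (h : algebraMap K M a + algebraMap K M b * s = 0) : a = 0 ∧ b = 0 := by
  have hb : b = 0 := by
    by_contra hb
    have h0 : algebraMap K M b ≠ 0 := by simpa using hb
    refine hc ⟨a / b, FaithfulSMul.algebraMap_injective K M ?_⟩
    rw [← hs, ← sq, div_pow, map_div₀, map_pow, map_pow, eq_div_iff (pow_ne_zero 2 h0)]
    linear_combination (algebraMap K M b * s - algebraMap K M a) * h
  subst hb
  exact ⟨by simpa using h, rfl⟩

/-- Corestriction of a quaternion algebra in terms of norms: if `Br(K(i)) = 0` and neither `f` nor
`-f` is a square, then every norm from `K(i)` is a norm from `K(√f)`. Indeed `z = x + y i` is the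
norm of some `t + s √f` with `t, s ∈ K(i)`, because `(z, f)` splits over `K(i)`. -/
theorem exists_eq_sq_sub_mul_sq_of_eq_sum_two_squares {K : Type u} [Field K]
    (h2 : (2 : K) ≠ 0) {M : Type u} [Field M] [Algebra K M]
    (hBr : Subsingleton (BrauerGroup.{u, u} M)) {i : M} (hi : i ^ 2 = -1)
    (hspan : ∀ z : M, ∃ a b : K, z = algebraMap K M a + algebraMap K M b * i)
    (hsq : ¬ IsSquare (-1 : K)) {f : K} (hf : ¬ IsSquare f) (hf' : ¬ IsSquare (-f)) (x y : K) :
    ∃ α β : K, x ^ 2 + y ^ 2 = α ^ 2 - f * β ^ 2 := by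
  have hinj := FaithfulSMul.algebraMap_injective K M
  have h2M : (2 : M) ≠ 0 := by
    intro h
    exact h2 (hinj (by rw [map_ofNat, h, map_zero]))
  have hcoord : ∀ a b a' b' : K, algebraMap K M a + algebraMap K M b * i =
      algebraMap K M a' + algebraMap K M b' * i → a = a' ∧ b = b' := by
    intro a b a' b' h
    obtain ⟨h1, h3⟩ := eq_zero_of_algebraMap_add_mul_eq_zero hsq
      (show i ^ 2 = algebraMap K M (-1) by rw [hi, map_neg, map_one]) (a := a - a') (b := b - b')
      (by rw [map_sub, map_sub]; linear_combination h)
    exact ⟨sub_eq_zero.1 h1, sub_eq_zero.1 h3⟩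
  obtain ⟨r, s, t, hne, h⟩ := exists_isotropic_of_subsingleton_brauerGroup M h2M hBr
    (algebraMap K M x + algebraMap K M y * i) (algebraMap K M f)
  have hr : r ≠ 0 := by
    rintro rfl
    have hs : s ≠ 0 := by
      rintro rfl
      have : t = 0 := by simpa using h.symm
      simp [this] at hne
    obtain ⟨p, q, hpq⟩ := hspan (t / s)
    have h1 : algebraMap K M f = (t / s) ^ 2 := by
      rw [div_pow, eq_div_iff (pow_ne_zero 2 hs), ← h]
      ring
    obtain ⟨e1, e2⟩ := hcoord f 0 (p ^ 2 - q ^ 2) (2 * p * q) (by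
      rw [h1, hpq]
      simp only [map_sub, map_mul, map_pow, map_ofNat, map_zero]
      linear_combination (algebraMap K M q) ^ 2 * hi)
    have e3 : p = 0 ∨ q = 0 := by simpa [h2] using e2.symm
    rcases e3 with rfl | rfl
    · exact hf' ⟨q, by rw [e1]; ring⟩
    · exact hf ⟨p, by rw [e1]; ring⟩
  obtain ⟨a, b, hab⟩ := hspan (t / r)
  obtain ⟨c, d, hcd⟩ := hspan (s / r)
  have h1 : algebraMap K M x + algebraMap K M y * i =
      (t / r) ^ 2 - algebraMap K M f * (s / r) ^ 2 := by
    field_simp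
    linear_combination h
  obtain ⟨rfl, rfl⟩ := hcoord x y (a ^ 2 - b ^ 2 - f * (c ^ 2 - d ^ 2))
    (2 * a * b - 2 * f * c * d) (by
      rw [h1, hab, hcd]
      simp only [map_sub, map_mul, map_pow, map_ofNat]
      linear_combination ((algebraMap K M b) ^ 2 - algebraMap K M f * (algebraMap K M d) ^ 2) * hi)
  -- The norm of `(a + b i) + (c + d i) √f` from `M(√f)` to `K(√f)` is `α + β √f`; the norm of the
  -- latter to `K` agrees with the norm taken through `M`.
  exact ⟨a ^ 2 + b ^ 2 + f * (c ^ 2 + d ^ 2), 2 * (a * c + b * d), by ring⟩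

/-- If `c` is not a square, `Br(K(√c)) = 0` and `-1` is not a sum of two squares, then `-c` is a sum
of three squares: the form `x² + y² + z²` is anisotropic over `K` but isotropic over `K(√c)`. -/
theorem neg_eq_sum_three_squares_of_subsingleton_brauerGroup {K : Type u} [Field K]
    (h2 : (2 : K) ≠ 0) {M : Type u} [Field M] [Algebra K M]
    (hBr : Subsingleton (BrauerGroup.{u, u} M)) {c : K} {s : M} (hs : s ^ 2 = algebraMap K M c)
    (hspan : ∀ z : M, ∃ a b : K, z = algebraMap K M a + algebraMap K M b * s)
    (hc : ¬ IsSquare c) (hneg : ∀ x y : K, x ^ 2 + y ^ 2 ≠ -1) :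
    ∃ x y z : K, -c = x ^ 2 + y ^ 2 + z ^ 2 := by
  have hinj := FaithfulSMul.algebraMap_injective K M
  have h2M : (2 : M) ≠ 0 := by
    intro h
    exact h2 (hinj (by rw [map_ofNat, h, map_zero]))
  -- Sums of three squares are anisotropic.
  have haniso : ∀ x y z : K, x ^ 2 + y ^ 2 + z ^ 2 = 0 → x = 0 ∧ y = 0 ∧ z = 0 := by
    have h0 : ∀ x y z : K, x ^ 2 + y ^ 2 + z ^ 2 = 0 → z = 0 := by
      intro x y z h
      by_contra hz
      refine hneg (x / z) (y / z) ?_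
      field_simp
      linear_combination h
    intro x y z h
    exact ⟨h0 y z x (by linear_combination h), h0 x z y (by linear_combination h), h0 x y z h⟩
  obtain ⟨x, y, z, hne, h⟩ := exists_isotropic_of_subsingleton_brauerGroup M h2M hBr (-1) (-1)
  obtain ⟨x₁, x₂, rfl⟩ := hspan x
  obtain ⟨y₁, y₂, rfl⟩ := hspan y
  obtain ⟨z₁, z₂, rfl⟩ := hspan z
  obtain ⟨e1, e2⟩ := eq_zero_of_algebraMap_add_mul_eq_zero hc hs
    (a := x₁ ^ 2 + y₁ ^ 2 + z₁ ^ 2 + c * (x₂ ^ 2 + y₂ ^ 2 + z₂ ^ 2))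
    (b := 2 * (x₁ * x₂ + y₁ * y₂ + z₁ * z₂)) (by
      simp only [map_add, map_mul, map_pow, map_ofNat, ← hs]
      linear_combination -h)
  have e3 : x₁ * x₂ + y₁ * y₂ + z₁ * z₂ = 0 := by simpa [h2] using e2
  have hn : x₂ ^ 2 + y₂ ^ 2 + z₂ ^ 2 ≠ 0 := by
    intro h0
    rw [h0, mul_zero, add_zero] at e1
    obtain ⟨rfl, rfl, rfl⟩ := haniso _ _ _ h0
    obtain ⟨rfl, rfl, rfl⟩ := haniso _ _ _ e1
    simp at hne
  -- Lagrange's identity for the orthogonal vectors `(x₁, y₁, z₁)` and `(x₂, y₂, z₂)`.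
  refine ⟨(y₁ * z₂ - z₁ * y₂) / (x₂ ^ 2 + y₂ ^ 2 + z₂ ^ 2),
    (z₁ * x₂ - x₁ * z₂) / (x₂ ^ 2 + y₂ ^ 2 + z₂ ^ 2),
    (x₁ * y₂ - y₁ * x₂) / (x₂ ^ 2 + y₂ ^ 2 + z₂ ^ 2), ?_⟩
  rw [div_pow, div_pow, div_pow, ← add_div, ← add_div, eq_div_iff (pow_ne_zero 2 hn)]
  linear_combination (-(x₂ ^ 2 + y₂ ^ 2 + z₂ ^ 2)) * e1 +
    (x₁ * x₂ + y₁ * y₂ + z₁ * z₂) * e3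

/-- If `-1` is not a sum of two squares, then the negative of a nonzero sum of two squares is not a
sum of two squares either, since these form a group under multiplication. -/
theorem sum_two_squares_eq_zero_of_eq_neg {K : Type*} [Field K]
    (hneg : ∀ x y : K, x ^ 2 + y ^ 2 ≠ -1)
    {a b c d : K} (h : a ^ 2 + b ^ 2 = -(c ^ 2 + d ^ 2)) : c ^ 2 + d ^ 2 = 0 := by
  by_contra h0
  refine hneg ((a * c + b * d) / (c ^ 2 + d ^ 2)) ((a * d - b * c) / (c ^ 2 + d ^ 2)) ?_
  rw [div_pow, div_pow, ← add_div, div_eq_iff (pow_ne_zero 2 h0)]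
  linear_combination (c ^ 2 + d ^ 2) * h

theorem theorem6p6 (K : Type u) [Field K] [PerfectField K]
    (hsq : ¬ IsSquare (-1 : K))
    (hG : IsProPGroup 2 (Field.absoluteGaloisGroup K))
    (hBr : BrauerGroupNeZero K) :
    IsRealClosed K ∨
      ∃ M : IntermediateField K (AlgebraicClosure K),
        Module.finrank K M = 2 ∧ BrauerGroupNeZero M := by
  by_contra! ⟨hreal, hM⟩
  have hM' : ∀ M : IntermediateField K (AlgebraicClosure K), Module.finrank K M = 2 →
      Subsingleton (BrauerGroup.{u, u} M) := fun M h => not_nontrivial_iff_subsingleton.1 (hM M h)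
  have h2 : (2 : K) ≠ 0 := by
    intro h
    exact hsq ⟨1, by linear_combination -h⟩
  obtain ⟨M, i, hfin, hi, hspan, hlift⟩ := exists_quadratic_extension hsq
  rw [map_neg, map_one] at hi
  have hMBr := hM' M hfin
  have hnorm := fun f => exists_eq_sq_sub_mul_sq_of_eq_sum_two_squares (f := f) h2 hMBr hi hspan hsq
  have hneg : ∀ x y : K, x ^ 2 + y ^ 2 ≠ -1 := by
    intro x y hxy
    obtain ⟨D, _, _, _, _, hD⟩ := exists_central_divisionRing_of_nontrivial_brauerGroup K hBr
    obtain ⟨d, hd⟩ := exists_sq_eq_neg_one_of_subsingleton_brauerGroup hfin hMBr hi hspan hD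
    obtain ⟨g, hg⟩ := hlift D d (by rw [hd, map_neg, map_one])
    obtain ⟨b, hb⟩ :=
      exists_not_sum_two_squares_of_sq_eq_neg_one h2 hsq hMBr hspan g hd hg
    -- As `-1 = x² + y²` is a norm from `K(√b)`, `b` is a sum of two squares.
    obtain ⟨α, β, h⟩ := hnorm b (fun ⟨s, hs⟩ => hb s 0 (by rw [hs]; ring))
      (fun ⟨s, hs⟩ => hb (s * x) (s * y) (by linear_combination -hs - s ^ 2 * hxy)) x y
    rw [hxy] at h
    have hβ : β ≠ 0 := by
      rintro rfl
      exact hsq ⟨α, by linear_combination h⟩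
    refine hb (1 / β) (α / β) ?_
    field_simp
    linear_combination h
  have hthree : ∀ c : K, ¬ IsSquare c → ∃ x y z : K, -c = x ^ 2 + y ^ 2 + z ^ 2 := by
    intro c hc
    obtain ⟨N, s, hN, hs, hNspan, -⟩ := exists_quadratic_extension hc
    exact neg_eq_sum_three_squares_of_subsingleton_brauerGroup h2 (hM' N hN) hs hNspan hc hneg
  have hpyth : ∀ p : K, IsSquare (1 + p ^ 2) := by
    intro p
    by_contra hp
    obtain ⟨v₁, v₂, v₃, hv⟩ := hthree _ hp
    have hm0 : v₁ ^ 2 + v₂ ^ 2 ≠ 0 := by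
      intro h0
      have := sum_two_squares_eq_zero_of_eq_neg hneg (a := v₃) (b := 0) (c := 1) (d := p)
        (by linear_combination -hv - h0)
      exact hp ⟨0, by linear_combination this⟩
    obtain ⟨α, β, h⟩ := hnorm (-(v₁ ^ 2 + v₂ ^ 2))
      (fun ⟨s, hs⟩ => by
        exact hm0 (sum_two_squares_eq_zero_of_eq_neg hneg (a := s) (b := 0)
          (by linear_combination -hs)))
      (fun ⟨s, hs⟩ => by
        rw [neg_neg] at hs
        have := sum_two_squares_eq_zero_of_eq_neg hneg (a := s) (b := v₃) (c := 1) (d := p)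
          (by linear_combination -hs - hv)
        exact hp ⟨0, by linear_combination this⟩) 1 p
    -- `α² + v₃² = -(v₁² + v₂²) (1 + β²)`, and the last product is a sum of two squares.
    have h0 := sum_two_squares_eq_zero_of_eq_neg hneg (a := α) (b := v₃)
      (c := v₁ - v₂ * β) (d := v₁ * β + v₂) (by linear_combination -h - hv)
    have h1 : (v₁ ^ 2 + v₂ ^ 2) * (1 + β ^ 2) = 0 := by linear_combination h0
    refine hsq ⟨β, ?_⟩
    linear_combination -(mul_eq_zero.1 h1).resolve_left hm0
  have hadd : ∀ x y : K, IsSquare (x ^ 2 + y ^ 2) := by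
    intro x y
    by_cases hx : x = 0
    · exact ⟨y, by rw [hx]; ring⟩
    · obtain ⟨r, hr⟩ := hpyth (y / x)
      refine ⟨x * r, ?_⟩
      field_simp at hr
      linear_combination hr
  have hsum : ∀ s : K, IsSumSq s → IsSquare s := by
    intro s hs
    induction hs with
    | zero => exact ⟨0, by simp⟩
    | sq_add a _ ih =>
      obtain ⟨t, rfl⟩ := ih
      simpa [sq] using hadd a t
  refine hreal
    { toIsSemireal := ?_
      isSquare_or_isSquare_neg := ?_
      exists_isRoot_of_odd_natDegree := ?_ }
  · exact isSemireal_iff_not_isSumSq_neg_one.2 fun h => hsq (hsum _ h)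
  · intro x
    by_contra! ⟨hx, hx'⟩
    obtain ⟨a, b, c, h⟩ := hthree x hx
    obtain ⟨t, ht⟩ := hadd a b
    rw [h, ht, ← sq] at hx'
    exact hx' (hadd t c)
  · exact fun hf => exists_isRoot_of_odd_natDegree_of_isProPGroup hG hf
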